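/- Let $S_n$ be the group of permutations of $[n]=\{1,\dots,n\}$. A family $\mathcal{A}\subset S_n$ is *intersecting* if for all $\sigma,\pi\in\mathcal{A}$ there is some $i\in[n]$ with $\sigma(i)=\pi(i)$; it is *centred* if there exist $i,j\in[n]$ such that $\sigma(i)=j$ for every $\sigma\in\mathcal{A}$. Let $d_m$ denote the number of derangements (permutations without fixed points) of $[m]$ (so $d_0=1$), and for $n\geq 2$ let $$\mathcal{C}=\mathcal{C}_n=\{\sigma\in S_n:\ \sigma(1)=1,\ \sigma(i)=i \text{ for some } i>2\}\cup\{(1\ 2)\}.$$ There exists $N$ such that the following holds for every $n\geq N$ (with $n\ge 2$). The family $\mathcal{C}$ is a non-centred intersecting family, and $$|\mathcal{C}|=(n-1)!-d_{n-1}-d_{n-2}+1 .$$ If $\mathcal{A}\subset S_n$ is any non-centred intersecting family, then $|\mathcal{A}|\leq|\mathcal{C}|$, and equality holds if and only if $\mathcal{A}$ is a double translate of $\mathcal{C}$, i.e. $\mathcal{A}=\pi\mathcal{C}\tau$ for some $\pi,\tau\in S_n$. Moreover, $|\mathcal{C}_n|=(1-1/e+o(1))(n-1)!$ as $n\to\infty$.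 -/

import Mathlib

namespace CameronKu

open Equiv

/-- A family of permutations of `[n]` is intersecting if any two members agree at some point. -/
def IsIntersecting {n : ℕ} (A : Finset (Perm (Fin n))) : Prop :=
  ∀ σ ∈ A, ∀ π ∈ A, ∃ i, σ i = π i

/-- A family is centred if, for some `i` and `j`, all of its members map `i` to `j`. -/
def IsCentred {n : ℕ} (A : Finset (Perm (Fin n))) : Prop :=
  ∃ i j, ∀ σ ∈ A, σ i = j

/-- The family `{σ : σ(1) = 1, σ(i) = i for some i > 2} ∪ {(1 2)}`. The points `1, 2, …, n` of
`[n]` are the elements `0, 1, …, n - 1` of `Fin n`, so `i > 2` becomes `1 < i`. -/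
def familyC (n : ℕ) (hn : 2 ≤ n) : Finset (Perm (Fin n)) :=
  Finset.univ.filter (fun σ : Perm (Fin n) => σ ⟨0, by omega⟩ = ⟨0, by omega⟩ ∧
      ∃ i : Fin n, 1 < i.val ∧ σ i = i) ∪
    {Equiv.swap ⟨0, by omega⟩ ⟨1, by omega⟩}

/-- `A` is a double translate of `F` if `A = π F τ` for some permutations `π` and `τ`. -/
def IsDoubleTranslate {n : ℕ} (A F : Finset (Perm (Fin n))) : Prop :=
  ∃ π τ : Perm (Fin n), A = F.image (fun σ => π * σ * τ)

end CameronKu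

namespace CameronKu

open Finset Equiv

/-! ### Minimum fragments and the weighted encoding count -/

section Spread

variable {U K ι : Type*} [DecidableEq U]

/-! A permutation is viewed as its graph, an `n`-subset of the grid, so that intersecting families
become intersecting set families, and the method of spread approximations applies. Two spread
families over disjoint cores contain members with disjoint graphs: colour the grid randomly with
four colours, two for each family; with probability above 1/2 a family has a member inside its own
two colours. This is proved in two rounds by counting minimum fragments (`sum_pow_card_fragment_le`,
`exists_disjoint_of_spread`).

For an intersecting `A`, the cores of size at most `q` of spread subfamilies therefore pairwise
intersect. Permutations containing no core are few. If the cores share a point, `A` is almost a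
star; otherwise every permutation containing a core contains one of at most `q ^ 2` pairs, and `A`
has order `(n - 2)!`, far below `|C| ~ (1 - 1/e)(n - 1)!`.

In the star case at most `(n - 3)!` members lie outside. One outsider `τ` confines `A` to a copy of
`C`. A second outsider excludes at least `d_{n-2} ≥ (n - 3)!` further star members, more than it can
repay (`IsIntersecting.card_lt_card_familyC`). -/

/-- The membership hypothesis sits inside the existential so that the choice is total in `i`;
outside `s` the value is the default `∅`. -/
theorem exists_fragment (F : ι → Finset U) (s : Finset ι) (W : Finset U) (i : ι) :
    ∃ T : Finset U, i ∈ s → T ⊆ F i ∧ Disjoint T W ∧ (∃ j ∈ s, F j ⊆ W ∪ T) ∧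
      ∀ j ∈ s, F j ⊆ F i ∪ W → #T ≤ #(F j \ W) := by
  classical
  by_cases hi : i ∈ s
  · obtain ⟨j, hj, hmin⟩ := (s.filter fun j => F j ⊆ F i ∪ W).exists_min_image
      (fun j => #(F j \ W)) ⟨i, by simp [hi]⟩
    simp only [mem_filter] at hj hmin
    refine ⟨F j \ W, fun _ => ⟨?_, sdiff_disjoint, ⟨j, hj.1, ?_⟩, fun l hl h => hmin l ⟨hl, h⟩⟩⟩
    · intro u hu
      rw [mem_sdiff] at hu
      exact (mem_union.1 (hj.2 hu.1)).resolve_right hu.2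
    · intro u hu
      by_cases h : u ∈ W <;> simp [h, hu]
  · exact ⟨∅, fun h => absurd h hi⟩

/-- A minimum fragment of `F i` with respect to `W`: a set `F j \ W` of least size among those
`j ∈ s` for which `F j ⊆ F i ∪ W`. -/
noncomputable def fragment (F : ι → Finset U) (s : Finset ι) (W : Finset U) (i : ι) : Finset U :=
  (exists_fragment F s W i).choose

section

variable {F : ι → Finset U} {s : Finset ι} {W : Finset U} {i : ι}

theorem fragment_subset (hi : i ∈ s) : fragment F s W i ⊆ F i :=
  ((exists_fragment F s W i).choose_spec hi).1

theorem disjoint_fragment (hi : i ∈ s) : Disjoint (fragment F s W i) W :=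
  ((exists_fragment F s W i).choose_spec hi).2.1

theorem exists_subset_union_fragment (hi : i ∈ s) : ∃ j ∈ s, F j ⊆ W ∪ fragment F s W i :=
  ((exists_fragment F s W i).choose_spec hi).2.2.1

theorem card_fragment_le (hi : i ∈ s) {j : ι} (hj : j ∈ s) (h : F j ⊆ F i ∪ W) :
    #(fragment F s W i) ≤ #(F j \ W) :=
  ((exists_fragment F s W i).choose_spec hi).2.2.2 j hj h

/-- Every member of the family that is covered by `W` together with a minimum fragment contains
that fragment. -/
theorem fragment_subset_of_subset (hi : i ∈ s) {j : ι} (hj : j ∈ s)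
    (h : F j ⊆ W ∪ fragment F s W i) : fragment F s W i ⊆ F j := by
  have h1 : F j \ W ⊆ fragment F s W i := by
    intro u hu
    rw [mem_sdiff] at hu
    exact (mem_union.1 (h hu.1)).resolve_left hu.2
  have h2 := card_fragment_le hi hj
    (h.trans (union_comm W _ ▸ union_subset_union_left (fragment_subset hi)))
  rw [← eq_of_subset_of_card_le h1 h2]
  exact sdiff_subset

end

/-- The set of points of colour `a`. -/
def colourClass {U K : Type*} [Fintype U] [DecidableEq K] (c : U → K) (a : K) : Finset U :=
  univ.filter fun u => c u = a

@[simp] theorem mem_colourClass {U K : Type*} [Fintype U] [DecidableEq K] {c : U → K} {a : K}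
    {u : U} : u ∈ colourClass c a ↔ c u = a := by
  simp [colourClass]

variable [Fintype U] [DecidableEq K]

theorem colourClass_piecewise (c : U → K) (a : K) (T : Finset U) :
    colourClass (T.piecewise (fun _ => a) c) a = colourClass c a ∪ T := by
  ext u
  by_cases h : u ∈ T <;> simp [h]

variable [Fintype K]

theorem card_filter_eq_off (c : U → K) (T : Finset U) :
    #(univ.filter fun d : U → K => ∀ u ∉ T, d u = c u) = Fintype.card K ^ #T := by
  have : (univ.filter fun d : U → K => ∀ u ∉ T, d u = c u) =
      Fintype.piFinset fun u => if u ∈ T then univ else {c u} := by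
    ext d
    simp only [mem_filter, mem_univ, true_and, Fintype.mem_piFinset]
    refine forall_congr' fun u => ?_
    by_cases h : u ∈ T <;> simp [h]
  rw [this, Fintype.card_piFinset, ← prod_subset (subset_univ T)]
  · rw [prod_congr rfl (g := fun _ => Fintype.card K), prod_const]
    intro u hu
    simp [hu]
  · intro u _ hu
    simp [hu]

/-- The weighted count of minimum fragments over a set of colourings that is stable under
recolouring points of `V`. -/
theorem sum_pow_card_fragment_le {F : ι → Finset U} {s : Finset ι} {V : Finset U}
    {Ω : Finset (U → K)} {a : K} {k : ℕ} {r M z : ℝ} (hr : 0 < r) (hz : 0 ≤ z)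
    (hV : ∀ i ∈ s, F i ⊆ V) (hk : ∀ i ∈ s, #(F i) ≤ k)
    (hΩ : ∀ c ∈ Ω, ∀ T ⊆ V, T.piecewise (fun _ => a) c ∈ Ω)
    (hM : ∀ X : Finset U, (#(s.filter fun i => X ⊆ F i) : ℝ) * r ^ #X ≤ M) :
    ∑ c ∈ Ω, ∑ i ∈ s, z ^ #(fragment F s (colourClass c a) i) ≤
      #Ω * (M * (1 + z * Fintype.card K / r) ^ k) := by
  classical
  have hM0 : 0 ≤ M := le_trans (by positivity) (hM ∅)
  rcases s.eq_empty_or_nonempty with rfl | ⟨i₀, hi₀⟩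
  · simp only [sum_empty, sum_const_zero]
    positivity
  -- The witness `j` depends on the colouring `d` alone: this is what lets a fragment be recovered
  -- cheaply from the recoloured `d`.
  have hG : ∀ d : U → K, ∃ j ∈ s, (∃ l ∈ s, F l ⊆ colourClass d a) → F j ⊆ colourClass d a := by
    intro d
    by_cases h : ∃ l ∈ s, F l ⊆ colourClass d a
    · obtain ⟨l, hl, h⟩ := h
      exact ⟨l, hl, fun _ => h⟩
    · exact ⟨i₀, hi₀, fun h' => absurd h' h⟩
  choose g hgs hg using hG
  set T : (U → K) × ι → Finset U := fun p => fragment F s (colourClass p.1 a) p.2 with hT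
  set R : (U → K) × ι → U → K := fun p => (T p).piecewise (fun _ => a) p.1 with hR
  rw [← sum_product' Ω s (fun c i => z ^ #(fragment F s (colourClass c a) i))]
  -- Encode `(c, i)` by the colouring in which its fragment has been recoloured `a`, and the
  -- fragment. The class of `a` then contains `F (g d)`, so by minimality the fragment is a subset
  -- of `F (g d)`.
  have hmaps : ∀ p ∈ Ω ×ˢ s, (⟨R p, T p⟩ : (_ : U → K) × Finset U) ∈
      Ω.sigma fun d => (F (g d)).powerset := by
    rintro ⟨c, i⟩ hp
    simp only [mem_product] at hp
    simp only [mem_sigma, mem_powerset]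
    have hcl : colourClass (R (c, i)) a = colourClass c a ∪ T (c, i) :=
      colourClass_piecewise _ _ _
    refine ⟨hΩ c hp.1 _ ((fragment_subset hp.2).trans (hV i hp.2)), ?_⟩
    apply fragment_subset_of_subset hp.2 (hgs _)
    have := hg (R (c, i)) (by
      rw [hcl]
      exact exists_subset_union_fragment hp.2)
    rwa [hcl] at this
  rw [← sum_fiberwise_of_maps_to hmaps, sum_sigma]
  -- Given the code `(d, X)`, only the colours on `X` are lost, and `i` ranges over members
  -- containing `X`, which spreadness bounds by `M / r ^ #X`.
  have hfib : ∀ d : U → K, ∀ X : Finset U,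
      ∑ p ∈ (Ω ×ˢ s).filter (fun p => (⟨R p, T p⟩ : (_ : U → K) × Finset U) = ⟨d, X⟩),
        z ^ #(fragment F s (colourClass p.1 a) p.2) ≤ M * (z * Fintype.card K / r) ^ #X := by
    intro d X
    have hsub : (Ω ×ˢ s).filter (fun p => (⟨R p, T p⟩ : (_ : U → K) × Finset U) = ⟨d, X⟩) ⊆
        (univ.filter fun c : U → K => ∀ u ∉ X, c u = d u) ×ˢ (s.filter fun i => X ⊆ F i) := by
      rintro ⟨c, i⟩ hp
      simp only [mem_filter, mem_product, Sigma.mk.injEq, heq_eq_eq] at hp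
      obtain ⟨⟨hc, hi⟩, hd, hX⟩ := hp
      simp only [mem_filter, mem_product, mem_univ, true_and]
      refine ⟨fun u hu => ?_, hi, hX ▸ fragment_subset hi⟩
      rw [← hd, hR]
      simp [hX, hu]
    calc _ = ∑ p ∈ (Ω ×ˢ s).filter
            (fun p => (⟨R p, T p⟩ : (_ : U → K) × Finset U) = ⟨d, X⟩), z ^ #X := by
          refine sum_congr rfl fun p hp => ?_
          simp only [mem_filter, Sigma.mk.injEq, heq_eq_eq] at hp
          rw [← hp.2.2]
      _ ≤ (Fintype.card K ^ #X * #(s.filter fun i => X ⊆ F i) : ℕ) * z ^ #X := by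
          rw [sum_const, nsmul_eq_mul]
          gcongr
          refine (card_le_card hsub).trans ?_
          rw [card_product, card_filter_eq_off]
      _ = (z * Fintype.card K / r) ^ #X * (#(s.filter fun i => X ⊆ F i) * r ^ #X) := by
          push_cast
          rw [div_pow, mul_pow]
          field_simp
      _ ≤ (z * Fintype.card K / r) ^ #X * M := by
          gcongr
          exact hM X
      _ = _ := mul_comm _ _
  calc _ ≤ ∑ d ∈ Ω, ∑ X ∈ (F (g d)).powerset, M * (z * Fintype.card K / r) ^ #X :=
        sum_le_sum fun d _ => sum_le_sum fun X _ => hfib d X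
    _ ≤ ∑ d ∈ Ω, M * (1 + z * Fintype.card K / r) ^ k := by
        refine sum_le_sum fun d _ => ?_
        rw [← mul_sum]
        have := sum_pow_mul_eq_add_pow (z * Fintype.card K / r) (1 : ℝ) (F (g d))
        simp only [one_pow, mul_one] at this
        rw [this, add_comm]
        gcongr
        · have : 0 ≤ z * Fintype.card K / r := by positivity
          linarith
        · exact hk _ (hgs d)
    _ = _ := by rw [sum_const, nsmul_eq_mul]

end Spread

/-! ### Two rounds of colour exposure -/

section TwoRounds

variable {U K ι : Type*} [DecidableEq U] [Fintype U] [Fintype K] [DecidableEq K]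

/-- In a spread family, few colourings leave many minimum fragments of size at least `t`. -/
theorem card_filter_large_fragments_lt {F : ι → Finset U} {s : Finset ι} {a : K} {n t : ℕ} {r : ℝ}
    (hs : s.Nonempty) (hr : 0 < r) (hn : ∀ i ∈ s, #(F i) ≤ n)
    (hM : ∀ X : Finset U, (#(s.filter fun i => X ⊆ F i) : ℝ) * r ^ #X ≤ 2 * #s)
    (ht : 16 * (1 + 2 * Fintype.card K / r) ^ n < 2 ^ t) :
    4 * (#(univ.filter fun c : U → K =>
      #s < 2 * #(s.filter fun i => t ≤ #(fragment F s (colourClass c a) i))) : ℝ) <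
        Fintype.card (U → K) := by
  classical
  set bad := univ.filter fun c : U → K =>
    #s < 2 * #(s.filter fun i => t ≤ #(fragment F s (colourClass c a) i)) with hbad
  have hs0 : (0 : ℝ) < #s := by exact_mod_cast hs.card_pos
  have key := sum_pow_card_fragment_le (Ω := (univ : Finset (U → K))) (V := univ) (a := a)
    (z := 2) hr (by norm_num) (fun i _ => subset_univ _) hn (fun _ _ _ _ => mem_univ _) hM
  have hlow : (#bad : ℝ) * (#s / 2 * 2 ^ t) ≤
      ∑ c : U → K, ∑ i ∈ s, (2 : ℝ) ^ #(fragment F s (colourClass c a) i) := by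
    rw [← nsmul_eq_mul, ← sum_const]
    refine (sum_le_sum fun c hc => ?_).trans
      (sum_le_sum_of_subset_of_nonneg (subset_univ bad) fun _ _ _ => by positivity)
    have hc' := (mem_filter.1 hc).2
    calc (#s : ℝ) / 2 * 2 ^ t
        ≤ #(s.filter fun i => t ≤ #(fragment F s (colourClass c a) i)) * 2 ^ t := by
          gcongr
          rw [div_le_iff₀ (by norm_num)]
          exact_mod_cast (by omega)
      _ = ∑ i ∈ s.filter (fun i => t ≤ #(fragment F s (colourClass c a) i)), (2 : ℝ) ^ t := by
          rw [sum_const, nsmul_eq_mul]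
      _ ≤ ∑ i ∈ s.filter (fun i => t ≤ #(fragment F s (colourClass c a) i)),
            (2 : ℝ) ^ #(fragment F s (colourClass c a) i) := by
          refine sum_le_sum fun i hi => ?_
          exact pow_le_pow_right₀ (by norm_num) (mem_filter.1 hi).2
      _ ≤ _ := sum_le_sum_of_subset_of_nonneg (filter_subset _ _) fun _ _ _ => by positivity
  have h := hlow.trans key
  rw [card_univ] at h
  have : Nonempty (U → K) := ⟨fun _ => a⟩
  have hN : (0 : ℝ) < Fintype.card (U → K) := by exact_mod_cast Fintype.card_pos
  set x := (1 + 2 * (Fintype.card K : ℝ) / r) ^ n with hx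
  have h2 : (0 : ℝ) < 2 ^ t := by positivity
  have h3 : (#bad : ℝ) * 2 ^ t ≤ 4 * Fintype.card (U → K) * x := by
    refine le_of_mul_le_mul_right ?_ hs0
    linarith
  nlinarith [mul_lt_mul_of_pos_left ht hN]

/-- In a spread family of small sets, few of the colourings with a given class of colour `a` have
no member inside the class of colour `b`. -/
theorem card_filter_not_subset_colourClass_le {F : ι → Finset U} {s : Finset ι} {a b : K} {t : ℕ}
    {r : ℝ} {W : Finset U} (hab : a ≠ b) (hs : s.Nonempty) (hr : 0 < r)
    (hW : ∀ i ∈ s, Disjoint (F i) W) (hn : ∀ i ∈ s, #(F i) ≤ t)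
    (hM : ∀ X : Finset U, (#(s.filter fun i => X ⊆ F i) : ℝ) * r ^ #X ≤ 4 * #s)
    (ht : (1 + 32 * Fintype.card K / r) ^ t < 2) :
    4 * (#(univ.filter fun c : U → K =>
      colourClass c a = W ∧ ∀ i ∈ s, ¬ F i ⊆ colourClass c b) : ℝ) ≤
        #(univ.filter fun c : U → K => colourClass c a = W) := by
  classical
  set Ω := univ.filter fun c : U → K => colourClass c a = W with hΩ
  set bad := univ.filter fun c : U → K =>
      colourClass c a = W ∧ ∀ i ∈ s, ¬ F i ⊆ colourClass c b with hbad
  have hs0 : (0 : ℝ) < #s := by exact_mod_cast hs.card_pos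
  have key := sum_pow_card_fragment_le (Ω := Ω) (V := Wᶜ) (a := b) (z := 32) hr (by norm_num)
    (fun i hi => subset_compl_iff_disjoint_right.2 (hW i hi)) hn (by
      intro c hc T hT
      simp only [hΩ, mem_filter, mem_univ, true_and] at hc ⊢
      rw [← hc] at hT ⊢
      ext u
      by_cases hu : u ∈ T
      · have := hT hu
        simp only [mem_compl, mem_colourClass] at this
        simp [hu, this, hab.symm]
      · simp [hu]) hM
  have hlow : (#bad : ℝ) * (#s * 32) ≤
      ∑ c ∈ Ω, ∑ i ∈ s, (32 : ℝ) ^ #(fragment F s (colourClass c b) i) := by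
    rw [← nsmul_eq_mul, ← sum_const]
    have hsub : bad ⊆ Ω := fun c hc => by
      simp only [hbad, hΩ, mem_filter] at hc ⊢
      exact ⟨hc.1, hc.2.1⟩
    refine (sum_le_sum fun c hc => ?_).trans
      (sum_le_sum_of_subset_of_nonneg hsub fun _ _ _ => by positivity)
    rw [← nsmul_eq_mul, ← sum_const]
    refine sum_le_sum fun i hi => ?_
    -- An empty fragment would put a member inside the class of `b`; hence on a bad colouring each
    -- fragment weighs at least 32.
    refine le_self_pow₀ (by norm_num) fun h0 => ?_
    obtain ⟨j, hj, hFj⟩ := exists_subset_union_fragment (W := colourClass c b) (F := F) hi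
    rw [card_eq_zero.1 h0, union_empty] at hFj
    exact (mem_filter.1 hc).2.2 j hj hFj
  have h := hlow.trans key
  have hΩ0 : (0 : ℝ) ≤ #Ω := by positivity
  have h3 : (#bad : ℝ) * 32 ≤ 4 * #Ω * (1 + 32 * (Fintype.card K : ℝ) / r) ^ t := by
    refine le_of_mul_le_mul_right ?_ hs0
    linarith
  nlinarith [mul_le_mul_of_nonneg_left ht.le hΩ0]

/-- For a spread family, more than half of all colourings have a member of the family whose points
have only the colours `a` and `b`. -/
theorem card_filter_forall_not_subset_lt {F : ι → Finset U} {s : Finset ι} {a b : K} {n t : ℕ}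
    {r : ℝ} (hab : a ≠ b) (hs : s.Nonempty) (hr : 0 < r) (hn : ∀ i ∈ s, #(F i) ≤ n)
    (hM : ∀ X : Finset U, (#(s.filter fun i => X ⊆ F i) : ℝ) * r ^ #X ≤ 2 * #s)
    (ht : 16 * (1 + 2 * Fintype.card K / r) ^ n < 2 ^ t)
    (ht' : (1 + 32 * Fintype.card K / r) ^ t < 2) :
    2 * #(univ.filter fun c : U → K =>
      ∀ i ∈ s, ¬ F i ⊆ colourClass c a ∪ colourClass c b) < Fintype.card (U → K) := by
  classical
  set P : Finset U → Prop := fun W => #s < 2 * #(s.filter fun i => t ≤ #(fragment F s W i)) with hP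
  have h1 := card_filter_large_fragments_lt (a := a) hs hr hn hM ht
  set bad := univ.filter fun c : U → K =>
      ∀ i ∈ s, ¬ F i ⊆ colourClass c a ∪ colourClass c b with hbad
  set bad₁ := univ.filter fun c : U → K => P (colourClass c a) with hbad₁
  -- Condition on the class `W` of colour `a`. If `W` is good, at least half the fragments have size
  -- below `t`; they inherit spreadness with constant 4, and `b` need only cover one of them.
  have hfib : ∀ W : Finset U, 4 * (#((bad \ bad₁).filter fun c => colourClass c a = W) : ℝ) ≤
      #(univ.filter fun c : U → K => colourClass c a = W) := by
    intro W
    by_cases hW : P W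
    · have : ((bad \ bad₁).filter fun c => colourClass c a = W) = ∅ := by
        refine filter_eq_empty_iff.2 fun c hc hcW => ?_
        refine (mem_sdiff.1 hc).2 (mem_filter.2 ⟨mem_univ _, ?_⟩)
        rwa [hcW]
      rw [this]
      simp
    set s' := s.filter fun i => ¬ t ≤ #(fragment F s W i) with hs'
    have hcard : #(s.filter fun i => t ≤ #(fragment F s W i)) + #s' = #s :=
      card_filter_add_card_filter_not _
    have hle : #s ≤ 2 * #s' := by
      simp only [hP, not_lt] at hW
      omega
    have hs'n : s'.Nonempty := by
      rw [← card_pos]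
      have := hs.card_pos
      omega
    have hsub : s' ⊆ s := filter_subset _ _
    refine le_trans ?_ (card_filter_not_subset_colourClass_le (F := fragment F s W) (s := s')
      (W := W) (t := t) hab hs'n hr (fun i hi => disjoint_fragment (hsub hi))
      (fun i hi => ?_) (fun X => ?_) ht')
    · gcongr
      intro c hc
      simp only [mem_filter, mem_sdiff, mem_univ, true_and, hbad] at hc ⊢
      refine ⟨hc.2, fun i hi hsubc => ?_⟩
      obtain ⟨j, hj, hFj⟩ := exists_subset_union_fragment (W := W) (F := F) (hsub hi)
      refine hc.1.1 j hj (hFj.trans ?_)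
      rw [hc.2]
      exact union_subset_union_right hsubc
    · exact (not_le.1 (mem_filter.1 hi).2).le
    · calc (#(s'.filter fun i => X ⊆ fragment F s W i) : ℝ) * r ^ #X
          ≤ #(s.filter fun i => X ⊆ F i) * r ^ #X := by
            gcongr
            intro i hi
            simp only [mem_filter] at hi ⊢
            exact ⟨hsub hi.1, hi.2.trans (fragment_subset (hsub hi.1))⟩
        _ ≤ 2 * #s := hM X
        _ ≤ 4 * #s' := by exact_mod_cast (by omega)
  have h2 : 4 * (#(bad \ bad₁) : ℝ) ≤ Fintype.card (U → K) := by
    have e1 := card_eq_sum_card_fiberwise (s := bad \ bad₁) (t := univ)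
      (f := fun c => colourClass c a) (fun _ _ => mem_univ _)
    have e2 := card_eq_sum_card_fiberwise (s := (univ : Finset (U → K))) (t := univ)
      (f := fun c => colourClass c a) (fun _ _ => mem_univ _)
    rw [← card_univ, e1, e2]
    push_cast
    rw [mul_sum]
    exact sum_le_sum fun W _ => hfib W
  have h3 : (#bad : ℝ) ≤ #(bad \ bad₁) + #bad₁ := by
    exact_mod_cast (card_le_card (subset_union_left (s₂ := bad₁))).trans
      (by rw [← sdiff_union_self_eq_union]; exact card_union_le _ _)
  have : (2 * #bad : ℝ) < Fintype.card (U → K) := by linarith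
  exact_mod_cast this

/-- Two spread families have disjoint members. -/
theorem exists_disjoint_of_spread {F G : ι → Finset U} {s s' : Finset ι} {n t : ℕ}
    {r : ℝ} (hs : s.Nonempty) (hs' : s'.Nonempty) (hr : 0 < r)
    (hF : ∀ i ∈ s, #(F i) ≤ n) (hG : ∀ i ∈ s', #(G i) ≤ n)
    (hFM : ∀ X : Finset U, (#(s.filter fun i => X ⊆ F i) : ℝ) * r ^ #X ≤ 2 * #s)
    (hGM : ∀ X : Finset U, (#(s'.filter fun i => X ⊆ G i) : ℝ) * r ^ #X ≤ 2 * #s')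
    (ht : 16 * (1 + 8 / r) ^ n < 2 ^ t) (ht' : (1 + 128 / r) ^ t < 2) :
    ∃ i ∈ s, ∃ j ∈ s', Disjoint (F i) (G j) := by
  classical
  have e1 : 16 * (1 + 2 * (Fintype.card (Fin 4) : ℝ) / r) ^ n < 2 ^ t := by
    norm_num [ht]
  have e2 : (1 + 32 * (Fintype.card (Fin 4) : ℝ) / r) ^ t < 2 := by
    norm_num [ht']
  have h1 := card_filter_forall_not_subset_lt (a := (0 : Fin 4)) (b := 1) (by decide) hs hr hF hFM
    e1 e2
  have h2 := card_filter_forall_not_subset_lt (a := (2 : Fin 4)) (b := 3) (by decide) hs' hr hG hGM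
    e1 e2
  have h3 : ∃ c : U → Fin 4, c ∉
      (univ.filter fun c : U → Fin 4 => ∀ i ∈ s, ¬ F i ⊆ colourClass c 0 ∪ colourClass c 1) ∪
      univ.filter fun c : U → Fin 4 => ∀ i ∈ s', ¬ G i ⊆ colourClass c 2 ∪ colourClass c 3 := by
    by_contra! h
    have := card_le_card (fun c _ => h c : (univ : Finset (U → Fin 4)) ⊆ _)
    have := this.trans (card_union_le _ _)
    rw [card_univ] at this
    omega
  obtain ⟨c, hc⟩ := h3
  simp only [mem_union, mem_filter, mem_univ, true_and, not_or, not_forall, not_not,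
    exists_prop] at hc
  obtain ⟨⟨i, hi, hic⟩, j, hj, hjc⟩ := hc
  refine ⟨i, hi, j, hj, disjoint_left.2 fun u hu hu' => ?_⟩
  have k1 := hic hu
  have k2 := hjc hu'
  simp only [mem_union, mem_colourClass] at k1 k2
  rcases k1 with k1 | k1 <;> rcases k2 with k2 | k2 <;> rw [k1] at k2 <;> exact absurd k2 (by decide)

end TwoRounds

/-! ### Spread approximation of intersecting families of permutations -/

section Stability

variable {n : ℕ}

/-- The graph of a permutation. -/
def graph (σ : Perm (Fin n)) : Finset (Fin n × Fin n) := univ.filter fun p => σ p.1 = p.2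

@[simp] theorem mem_graph {σ : Perm (Fin n)} {p : Fin n × Fin n} :
    p ∈ graph σ ↔ σ p.1 = p.2 := by
  simp [graph]

theorem card_graph (σ : Perm (Fin n)) : #(graph σ) = n := by
  have : graph σ = univ.image fun x => (x, σ x) := by
    ext ⟨x, y⟩
    simp
  rw [this, card_image_of_injective _ fun x y h => (Prod.ext_iff.1 h).1, card_univ, Fintype.card_fin]

theorem card_filter_eqOn (σ : Perm (Fin n)) (D : Finset (Fin n)) :
    #(univ.filter fun π : Perm (Fin n) => ∀ x ∈ D, π x = σ x) = (n - #D).factorial := by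
  have h1 : #(univ.filter fun π : Perm (Fin n) => ∀ x ∈ D, π x = σ x) =
      #(univ.filter fun π : Perm (Fin n) => ∀ x, ¬ x ∉ D → π x = x) := by
    refine card_bij' (fun π _ => σ⁻¹ * π) (fun π _ => σ * π) ?_ ?_ ?_ ?_
    · intro π hπ
      simp only [mem_filter, mem_univ, true_and, not_not, Perm.mul_apply] at hπ ⊢
      intro x hx
      rw [hπ x hx]
      exact σ.symm_apply_apply x
    · intro π hπ
      simp only [mem_filter, mem_univ, true_and, not_not, Perm.mul_apply] at hπ ⊢
      intro x hx
      rw [hπ x hx]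
    · simp
    · simp
  rw [h1, ← Fintype.card_subtype, ← Fintype.card_congr (Perm.subtypeEquivSubtypePerm (· ∉ D)),
    Fintype.card_perm, Fintype.card_subtype_compl, Fintype.card_fin, Fintype.card_coe]

theorem card_filter_subset_graph_le {A : Finset (Perm (Fin n))} {X : Finset (Fin n × Fin n)}
    (h : (A.filter fun σ => X ⊆ graph σ).Nonempty) :
    #X ≤ n ∧ #(A.filter fun σ => X ⊆ graph σ) ≤ (n - #X).factorial := by
  obtain ⟨σ, hσ⟩ := h
  have hX := (mem_filter.1 hσ).2
  refine ⟨(card_le_card hX).trans (card_graph σ).le, ?_⟩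
  have hinj : Set.InjOn Prod.fst (X : Set (Fin n × Fin n)) := by
    intro p hp q hq hpq
    have h1 := mem_graph.1 (hX hp)
    have h2 := mem_graph.1 (hX hq)
    exact Prod.ext hpq (by rw [← h1, ← h2, hpq])
  rw [← card_image_of_injOn hinj, ← card_filter_eqOn σ]
  refine card_le_card fun π hπ => ?_
  simp only [mem_filter, mem_univ, true_and, mem_image, forall_exists_index, and_imp] at hπ ⊢
  rintro x p hp rfl
  rw [mem_graph.1 (hX hp), mem_graph.1 (hπ.2 hp)]

/-- All members of `B` contain `X`, and `B` is `r`-spread outside `X`. -/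
def IsSpreadOver (r : ℝ) (B : Finset (Perm (Fin n))) (X : Finset (Fin n × Fin n)) : Prop :=
  B.Nonempty ∧ (∀ σ ∈ B, X ⊆ graph σ) ∧
    ∀ Z, Disjoint Z X → (#(B.filter fun σ => Z ⊆ graph σ) : ℝ) * r ^ #Z ≤ #B

/-- Take `X` maximising `r ^ #X` times the number of members containing `X`: comparison with `Z ∪ X`
gives spreadness, comparison with `∅` gives the size bound. -/
theorem exists_isSpreadOver {r : ℝ} (hr : 0 < r) {B : Finset (Perm (Fin n))} (hB : B.Nonempty) :
    ∃ X, IsSpreadOver r (B.filter fun σ => X ⊆ graph σ) X ∧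
      (#B : ℝ) ≤ r ^ #X * #(B.filter fun σ => X ⊆ graph σ) := by
  obtain ⟨X, -, hX⟩ := (univ : Finset (Finset (Fin n × Fin n))).exists_max_image
    (fun X => r ^ #X * (#(B.filter fun σ => X ⊆ graph σ) : ℝ)) ⟨∅, mem_univ _⟩
  have h0 : (#B : ℝ) ≤ r ^ #X * #(B.filter fun σ => X ⊆ graph σ) := by
    have := hX ∅ (mem_univ _)
    simpa using this
  refine ⟨X, ⟨?_, fun σ hσ => (mem_filter.1 hσ).2, fun Z hZ => ?_⟩, h0⟩
  · rw [← card_pos]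
    by_contra h
    have hB0 : (0 : ℝ) < #B := by exact_mod_cast hB.card_pos
    rw [Nat.eq_zero_of_not_pos h] at h0
    simp only [Nat.cast_zero, mul_zero] at h0
    linarith
  · have := hX (Z ∪ X) (mem_univ _)
    rw [card_union_of_disjoint hZ, pow_add] at this
    have hr' : 0 < r ^ #X := by positivity
    refine le_of_mul_le_mul_left ?_ hr'
    refine le_trans (le_of_eq ?_) this
    have e : (B.filter fun σ => X ⊆ graph σ).filter (fun σ => Z ⊆ graph σ) =
        B.filter fun σ => Z ∪ X ⊆ graph σ := by
      ext σ
      simp only [mem_filter, union_subset_iff]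
      tauto
    rw [e]
    ring

/-- Union bound: a point outside `X` lies in at most `#B / r` of the graphs, and there are at most
`r / 2` points in `Y`. -/
theorem IsSpreadOver.card_le_two_mul {r : ℝ} {B : Finset (Perm (Fin n))}
    {X Y : Finset (Fin n × Fin n)} (hB : IsSpreadOver r B X) (hXY : Disjoint X Y)
    (hr : 0 < r) (hY : 2 * (#Y : ℝ) ≤ r) :
    #B ≤ 2 * #(B.filter fun σ => Disjoint (graph σ) Y) := by
  have h1 : (#(B.filter fun σ => ¬ Disjoint (graph σ) Y) : ℝ) ≤ #Y * (#B / r) := by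
    have hsub : (B.filter fun σ => ¬ Disjoint (graph σ) Y) ⊆
        Y.biUnion fun y => B.filter fun σ => {y} ⊆ graph σ := by
      intro σ hσ
      simp only [mem_filter, not_disjoint_iff] at hσ
      obtain ⟨hσ, y, hy, hyY⟩ := hσ
      simp only [mem_biUnion, mem_filter, singleton_subset_iff]
      exact ⟨y, hyY, hσ, hy⟩
    calc (#(B.filter fun σ => ¬ Disjoint (graph σ) Y) : ℝ)
        ≤ ∑ y ∈ Y, (#(B.filter fun σ => {y} ⊆ graph σ) : ℝ) := by
          exact_mod_cast (card_le_card hsub).trans card_biUnion_le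
      _ ≤ ∑ y ∈ Y, (#B : ℝ) / r := by
          refine sum_le_sum fun y hy => ?_
          rw [le_div_iff₀ hr]
          have := hB.2.2 {y} (disjoint_singleton_left.2 fun h => disjoint_left.1 hXY h hy)
          simpa using this
      _ = _ := by rw [sum_const, nsmul_eq_mul]
  have h2 : (#Y : ℝ) * (#B / r) ≤ #B / 2 := by
    rw [← mul_div_assoc, div_le_div_iff₀ hr (by norm_num)]
    nlinarith [(Nat.cast_nonneg #B : (0 : ℝ) ≤ #B)]
  have h3 : (#(B.filter fun σ => Disjoint (graph σ) Y) : ℝ) +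
      #(B.filter fun σ => ¬ Disjoint (graph σ) Y) = #B := by
    exact_mod_cast card_filter_add_card_filter_not _
  have : (#B : ℝ) ≤ 2 * #(B.filter fun σ => Disjoint (graph σ) Y) := by linarith
  exact_mod_cast this

theorem IsSpreadOver.card_filter_sdiff_mul_le {r : ℝ} {B : Finset (Perm (Fin n))}
    {X Y : Finset (Fin n × Fin n)} (hB : IsSpreadOver r B X) (hXY : Disjoint X Y)
    (hr : 0 < r) (hY : 2 * (#Y : ℝ) ≤ r) (Z : Finset (Fin n × Fin n)) :
    (#((B.filter fun σ => Disjoint (graph σ) Y).filter fun σ => Z ⊆ graph σ \ X) : ℝ) * r ^ #Z ≤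
      2 * #(B.filter fun σ => Disjoint (graph σ) Y) := by
  by_cases hZ : Disjoint Z X
  · calc _ ≤ (#(B.filter fun σ => Z ⊆ graph σ) : ℝ) * r ^ #Z := by
          gcongr
          intro σ hσ
          simp only [mem_filter] at hσ ⊢
          exact ⟨hσ.1.1, hσ.2.trans sdiff_subset⟩
      _ ≤ #B := hB.2.2 Z hZ
      _ ≤ _ := by exact_mod_cast hB.card_le_two_mul hXY hr hY
  · have : (B.filter fun σ => Disjoint (graph σ) Y).filter (fun σ => Z ⊆ graph σ \ X) = ∅ := by
      refine filter_eq_empty_iff.2 fun σ _ h => hZ ?_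
      exact disjoint_of_subset_left h sdiff_disjoint
    rw [this]
    simp

/-- Spread families over disjoint sets have members with disjoint graphs. -/
theorem IsSpreadOver.exists_disjoint {r : ℝ} {t : ℕ} {B B' : Finset (Perm (Fin n))}
    {X Y : Finset (Fin n × Fin n)} (hB : IsSpreadOver r B X) (hB' : IsSpreadOver r B' Y)
    (hXY : Disjoint X Y) (hr : 0 < r) (hX : 2 * (#X : ℝ) ≤ r) (hY : 2 * (#Y : ℝ) ≤ r)
    (ht : 16 * (1 + 8 / r) ^ n < 2 ^ t) (ht' : (1 + 128 / r) ^ t < 2) :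
    ∃ σ ∈ B, ∃ π ∈ B', Disjoint (graph σ) (graph π) := by
  have c1 := hB.card_le_two_mul hXY hr hY
  have c2 := hB'.card_le_two_mul hXY.symm hr hX
  have p1 := hB.1.card_pos
  have p2 := hB'.1.card_pos
  -- Discard members of each family that meet the other's core and delete its own core from the
  -- rest. A common point of the two graphs would then lie outside both cores, contradicting
  -- disjointness of the remainders.
  obtain ⟨σ, hσ, π, hπ, h⟩ := exists_disjoint_of_spread
    (F := fun σ : Perm (Fin n) => graph σ \ X) (G := fun σ => graph σ \ Y)
    (s := B.filter fun σ => Disjoint (graph σ) Y) (s' := B'.filter fun σ => Disjoint (graph σ) X)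
    (n := n) (card_pos.1 (by omega)) (card_pos.1 (by omega)) hr
    (fun σ _ => (card_le_card sdiff_subset).trans (card_graph σ).le)
    (fun σ _ => (card_le_card sdiff_subset).trans (card_graph σ).le)
    (hB.card_filter_sdiff_mul_le hXY hr hY) (hB'.card_filter_sdiff_mul_le hXY.symm hr hX) ht ht'
  simp only [mem_filter] at hσ hπ
  refine ⟨σ, hσ.1, π, hπ.1, disjoint_left.2 fun p hp hp' => ?_⟩
  exact disjoint_left.1 h (mem_sdiff.2 ⟨hp, disjoint_left.1 hπ.2 hp'⟩)
    (mem_sdiff.2 ⟨hp', disjoint_left.1 hσ.2 hp⟩)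

/-- An intersecting family of permutations is either small or close to a star. -/
theorem IsIntersecting.exists_card_filter_le_or_card_le {A : Finset (Perm (Fin n))}
    (hA : IsIntersecting A) {r R : ℝ} {q t : ℕ} (hn : 0 < n) (hr : 0 < r) (hR : 0 ≤ R)
    (hq : 2 * (q : ℝ) ≤ r)
    (ht : 16 * (1 + 8 / r) ^ n < 2 ^ t) (ht' : (1 + 128 / r) ^ t < 2)
    (hrem : ∀ k, q < k → k ≤ n → r ^ k * ((n - k).factorial : ℝ) ≤ R) :
    (∃ i j, (#(A.filter fun σ => σ i ≠ j) : ℝ) ≤ R) ∨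
      (#A : ℝ) ≤ q ^ 2 * (n - 2).factorial + R := by
  classical
  set S : Finset (Finset (Fin n × Fin n)) :=
    univ.filter fun X => #X ≤ q ∧ ∃ B ⊆ A, IsSpreadOver r B X with hS
  have hint : ∀ X ∈ S, ∀ Y ∈ S, ∃ p ∈ X, p ∈ Y := by
    intro X hX Y hY
    simp only [hS, mem_filter, mem_univ, true_and] at hX hY
    obtain ⟨hXq, B, hBA, hB⟩ := hX
    obtain ⟨hYq, B', hBA', hB'⟩ := hY
    by_contra! hXY
    have e1 : (#X : ℝ) ≤ q := by exact_mod_cast hXq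
    have e2 : (#Y : ℝ) ≤ q := by exact_mod_cast hYq
    obtain ⟨σ, hσ, π, hπ, h⟩ := hB.exists_disjoint hB' (disjoint_left.2 hXY) hr (by linarith)
      (by linarith) ht ht'
    obtain ⟨i, hi⟩ := hA σ (hBA hσ) π (hBA' hπ)
    exact disjoint_left.1 h (mem_graph.2 (rfl : σ (i, σ i).1 = _)) (mem_graph.2 hi.symm)
  set A₀ := A.filter fun σ => ∀ X ∈ S, ¬ X ⊆ graph σ with hA₀
  have hA₀R : (#A₀ : ℝ) ≤ R := by
    rcases A₀.eq_empty_or_nonempty with h | h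
    · simpa [h] using hR
    obtain ⟨X, hX, hle⟩ := exists_isSpreadOver hr h
    -- A small core of a spread part of `A₀` would belong to `S`, yet members of `A₀` contain no set
    -- from `S`.
    have hXq : q < #X := by
      by_contra! hXq
      have hXS : X ∈ S := mem_filter.2
        ⟨mem_univ _, hXq, _, (filter_subset _ _).trans (filter_subset _ _), hX⟩
      obtain ⟨σ, hσ⟩ := hX.1
      simp only [hA₀, mem_filter] at hσ
      exact hσ.1.2 X hXS hσ.2
    obtain ⟨h1, h2⟩ := card_filter_subset_graph_le hX.1
    refine hle.trans (le_trans ?_ (hrem _ hXq h1))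
    gcongr
  by_cases hp : ∃ p : Fin n × Fin n, ∀ X ∈ S, p ∈ X
  · obtain ⟨⟨i, j⟩, hp⟩ := hp
    refine Or.inl ⟨i, j, le_trans ?_ hA₀R⟩
    gcongr
    intro σ hσ
    simp only [hA₀, mem_filter] at hσ ⊢
    exact ⟨hσ.1, fun X hX h => hσ.2 (mem_graph.1 (h (hp X hX)))⟩
  · push Not at hp
    right
    obtain ⟨X₁, hX₁, -⟩ := hp (⟨0, hn⟩, ⟨0, hn⟩)
    choose g hgS hg using hp
    -- A core inside `σ` meets `X₁` in some `x`, and meets `g x`, a core avoiding `x`, in some `y ≠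
    -- x`.
    have hcover : A ⊆ A₀ ∪ X₁.biUnion fun x => (g x).biUnion fun y =>
        A.filter fun σ => {x, y} ⊆ graph σ := by
      intro σ hσ
      by_cases h : σ ∈ A₀
      · exact mem_union_left _ h
      · simp only [hA₀, mem_filter, hσ, true_and, not_forall, not_not] at h
        obtain ⟨X, hX, hXσ⟩ := h
        obtain ⟨x, hx, hx₁⟩ := hint X hX X₁ hX₁
        obtain ⟨y, hy, hyg⟩ := hint X hX (g x) (hgS x)
        refine mem_union_right _ (mem_biUnion.2 ⟨x, hx₁, mem_biUnion.2 ⟨y, hyg, mem_filter.2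
          ⟨hσ, insert_subset (hXσ hx) (singleton_subset_iff.2 (hXσ hy))⟩⟩⟩)
    have hpair : ∀ x, ∀ y ∈ g x,
        #(A.filter fun σ => {x, y} ⊆ graph σ) ≤ (n - 2).factorial := by
      intro x y hy
      rcases (A.filter fun σ => {x, y} ⊆ graph σ).eq_empty_or_nonempty with h | h
      · simp [h]
      · have := (card_filter_subset_graph_le h).2
        have hne : x ≠ y := fun e => hg x (by rwa [← e] at hy)
        rwa [card_pair hne] at this
    have hSq : ∀ X ∈ S, #X ≤ q := fun X hX => (mem_filter.1 hX).2.1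
    have hcard : #A ≤ #A₀ + q * (q * (n - 2).factorial) := by
      refine (card_le_card hcover).trans ((card_union_le _ _).trans ?_)
      gcongr
      refine (card_biUnion_le_card_mul _ _ (q * (n - 2).factorial) fun x _ => ?_).trans ?_
      · refine (card_biUnion_le_card_mul _ _ (n - 2).factorial fun y hy => hpair x y hy).trans ?_
        gcongr
        exact hSq _ (hgS x)
      · gcongr
        exact hSq _ hX₁
    have : (#A : ℝ) ≤ #A₀ + q * (q * (n - 2).factorial) := by exact_mod_cast hcard
    rw [sq, mul_assoc]
    linarith

end Stability

/-! ### Numerical estimates and the choice of parameters -/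

section Bounds

/-- Compared factor by factor: `n * (k - i) ≤ k * (n - i)` since `k ≤ n`. -/
theorem pow_mul_factorial_le_pow_mul_descFactorial {n k : ℕ} (hk : k ≤ n) :
    n ^ k * k.factorial ≤ k ^ k * n.descFactorial k := by
  rw [← Nat.descFactorial_self k, Nat.descFactorial_eq_prod_range, Nat.descFactorial_eq_prod_range,
    pow_eq_prod_const, pow_eq_prod_const, ← prod_mul_distrib, ← prod_mul_distrib]
  refine prod_le_prod' fun i hi => ?_
  have hi' := mem_range.1 hi
  obtain ⟨c, rfl⟩ := Nat.exists_eq_add_of_le hi'.le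
  obtain ⟨d, rfl⟩ := Nat.exists_eq_add_of_le hk
  rw [show i + c - i = c by omega, show i + c + d - i = c + d by omega]
  nlinarith [Nat.zero_le (i * d)]

theorem pow_le_three_pow_mul_descFactorial {n k : ℕ} (hk : k ≤ n) :
    n ^ k ≤ 3 ^ k * n.descFactorial k := by
  have h1 := pow_mul_factorial_le_pow_mul_descFactorial hk
  have h2 : (k : ℝ) ^ k ≤ 3 ^ k * k.factorial := by
    have h := Real.pow_div_factorial_le_exp (k : ℝ) (Nat.cast_nonneg k) k
    rw [div_le_iff₀ (by positivity)] at h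
    refine h.trans ?_
    gcongr
    rw [← Real.exp_one_pow]
    gcongr
    exact Real.exp_one_lt_three.le
  have h2' : k ^ k ≤ 3 ^ k * k.factorial := by exact_mod_cast h2
  refine Nat.le_of_mul_le_mul_right ?_ k.factorial_pos
  calc n ^ k * k.factorial ≤ k ^ k * n.descFactorial k := h1
    _ ≤ 3 ^ k * k.factorial * n.descFactorial k := by gcongr
    _ = _ := by ring

/-- After multiplication by `m ^ k` it is enough that `3 ^ k * n ^ 3 ≤ m ^ k`. As `n ^ 3 ≤ 8 * m ^
12`, this needs `k ≥ 13`, whence `q = 12`, and `m ≥ 8 * 3 ^ 13`. -/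
theorem pow_mul_factorial_sub_le {m n k : ℕ} (hm : 8 * 3 ^ 13 ≤ m) (hmn : m ^ 4 ≤ n)
    (hnm : n ≤ 2 * m ^ 4) (hk : 12 < k) (hkn : k ≤ n) :
    (m ^ 3) ^ k * (n - k).factorial ≤ (n - 3).factorial := by
  have hm0 : 0 < m := by omega
  have h1 : n.factorial ≤ n ^ 3 * (n - 3).factorial := by
    rw [← Nat.factorial_mul_descFactorial (show 3 ≤ n by omega), mul_comm]
    gcongr
    exact Nat.descFactorial_le_pow n 3
  have h2 : 3 ^ k * n ^ 3 ≤ m ^ k := by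
    obtain ⟨l, rfl⟩ := Nat.exists_eq_add_of_le (show 13 ≤ k by omega)
    calc 3 ^ (13 + l) * n ^ 3 ≤ 3 ^ (13 + l) * (2 * m ^ 4) ^ 3 := by gcongr
      _ = (8 * 3 ^ 13) * m ^ 12 * 3 ^ l := by ring
      _ ≤ m * m ^ 12 * m ^ l := by
        gcongr
        exact le_trans (by norm_num) hm
      _ = m ^ (13 + l) := by ring
  refine Nat.le_of_mul_le_mul_left ?_ (pow_pos hm0 k)
  calc m ^ k * ((m ^ 3) ^ k * (n - k).factorial) = (m ^ 4) ^ k * (n - k).factorial := by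
        rw [← mul_assoc, ← mul_pow]
        ring
    _ ≤ n ^ k * (n - k).factorial := by gcongr
    _ ≤ 3 ^ k * n.descFactorial k * (n - k).factorial := by
        gcongr
        exact pow_le_three_pow_mul_descFactorial hkn
    _ = 3 ^ k * n.factorial := by
        rw [mul_assoc, mul_comm (n.descFactorial k), Nat.factorial_mul_descFactorial hkn]
    _ ≤ 3 ^ k * (n ^ 3 * (n - 3).factorial) := by gcongr
    _ = 3 ^ k * n ^ 3 * (n - 3).factorial := by ring
    _ ≤ m ^ k * (n - 3).factorial := by gcongr

theorem one_add_div_pow_le_exp {x r : ℝ} (hx : 0 ≤ x) (hr : 0 < r) (k : ℕ) :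
    (1 + x / r) ^ k ≤ Real.exp (k * (x / r)) := by
  rw [Real.exp_nat_mul]
  have : 0 ≤ x / r := by positivity
  gcongr
  linarith [Real.add_one_le_exp (x / r)]

theorem sixteen_mul_pow_lt {m n : ℕ} (hm : 0 < m) (hnm : n ≤ 2 * m ^ 4) :
    16 * (1 + 8 / ((m : ℝ) ^ 3)) ^ n < 2 ^ (32 * m) := by
  have hm0 : (0 : ℝ) < m := by exact_mod_cast hm
  have hn : (n : ℝ) ≤ 2 * m ^ 4 := by exact_mod_cast hnm
  calc 16 * (1 + 8 / ((m : ℝ) ^ 3)) ^ n ≤ 16 * Real.exp (n * (8 / (m : ℝ) ^ 3)) := by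
        gcongr
        exact one_add_div_pow_le_exp (by norm_num) (by positivity) n
    _ ≤ 16 * Real.exp ((16 * m : ℕ) : ℝ) := by
        gcongr
        rw [← mul_div_assoc, div_le_iff₀ (by positivity)]
        push_cast
        nlinarith
    _ ≤ 16 * 3 ^ (16 * m) := by
        rw [← Real.exp_one_pow]
        gcongr
        exact Real.exp_one_lt_three.le
    _ ≤ 16 ^ m * 3 ^ (16 * m) := by
        gcongr
        exact le_self_pow₀ (by norm_num) hm.ne'
    _ = (16 * 3 ^ 16) ^ m := by rw [mul_pow, pow_mul]
    _ < (2 ^ 32) ^ m := by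
        gcongr
        norm_num
    _ = 2 ^ (32 * m) := by rw [pow_mul]

theorem one_add_pow_lt_two {m : ℕ} (hm : 100 ≤ m) :
    (1 + 128 / ((m : ℝ) ^ 3)) ^ (32 * m) < 2 := by
  have hm0 : (100 : ℝ) ≤ m := by exact_mod_cast hm
  have h1 : (1 + 128 / ((m : ℝ) ^ 3)) ^ (32 * m) ≤ Real.exp (1 / 2) := by
    refine (one_add_div_pow_le_exp (by norm_num) (by positivity) _).trans ?_
    gcongr
    rw [← mul_div_assoc, div_le_iff₀ (by positivity)]
    push_cast
    nlinarith [mul_le_mul hm0 hm0 (by norm_num) (by linarith)]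
  refine h1.trans_lt ?_
  refine lt_of_pow_lt_pow_left₀ 2 (by norm_num) ?_
  rw [← Real.exp_nat_mul]
  norm_num
  linarith [Real.exp_one_lt_three]

/-- For large `n`, an intersecting family in `S_n` that is not small lies in a star, up to
`(n - 3)!` permutations. -/
theorem exists_forall_isIntersecting_stability : ∃ N : ℕ, ∀ n, N ≤ n →
    ∀ A : Finset (Perm (Fin n)), IsIntersecting A →
      (∃ i j, #(A.filter fun σ => σ i ≠ j) ≤ (n - 3).factorial) ∨
        #A ≤ 144 * (n - 2).factorial + (n - 3).factorial := by
  refine ⟨(8 * 3 ^ 13) ^ 4, fun n hn A hA => ?_⟩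
  -- With `m` about `n ^ (1/4)` and `r = m ^ 3`, the first round needs `t` of order `n / r ~ m` and
  -- the second needs `t` well below `r`; `t = 32 * m` meets both.
  obtain ⟨m, hm, hmn, hnm⟩ : ∃ m, 8 * 3 ^ 13 ≤ m ∧ m ^ 4 ≤ n ∧ n ≤ 2 * m ^ 4 := by
    refine ⟨n.sqrt.sqrt, ?_, ?_, ?_⟩
    · rw [Nat.le_sqrt', Nat.le_sqrt', ← pow_mul]
      exact hn
    · rw [show 4 = 2 * 2 from rfl, pow_mul]
      exact (Nat.pow_le_pow_left (Nat.sqrt_le' _) 2).trans (Nat.sqrt_le' n)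
    · have h0 : 8 * 3 ^ 13 ≤ n.sqrt.sqrt := by
        rw [Nat.le_sqrt', Nat.le_sqrt', ← pow_mul]
        exact hn
      have h1 : n.sqrt + 1 ≤ (n.sqrt.sqrt + 1) ^ 2 := Nat.succ_le_of_lt (Nat.lt_succ_sqrt' _)
      have h2 : n < (n.sqrt + 1) ^ 2 := Nat.lt_succ_sqrt' n
      have h3 := Nat.pow_le_pow_left h1 2
      generalize n.sqrt.sqrt = m at *
      have h4 : ((m + 1) ^ 2) ^ 2 ≤ 2 * m ^ 4 := by
        obtain ⟨d, rfl⟩ := Nat.exists_eq_add_of_le (show 10 ≤ m by omega)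
        ring_nf
        nlinarith [Nat.zero_le d, Nat.zero_le (d ^ 2), Nat.zero_le (d ^ 3), Nat.zero_le (d ^ 4)]
      omega
  have hm0 : (100 : ℝ) ≤ m := by exact_mod_cast (show 100 ≤ m by omega)
  have hn0 : 0 < n := lt_of_lt_of_le (by positivity) hn
  have key := hA.exists_card_filter_le_or_card_le (r := (m : ℝ) ^ 3) (q := 12) (t := 32 * m)
    (R := (n - 3).factorial) hn0 (by positivity) (by positivity) (by
      norm_num
      nlinarith [mul_le_mul hm0 hm0 (by norm_num) (by linarith)])
    (sixteen_mul_pow_lt (by omega) hnm) (one_add_pow_lt_two (by omega))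
    (fun k hk hkn => by exact_mod_cast pow_mul_factorial_sub_le hm hmn hnm hk hkn)
  rcases key with ⟨i, j, h⟩ | h
  · exact Or.inl ⟨i, j, by exact_mod_cast h⟩
  · right
    norm_num at h
    exact_mod_cast h

end Bounds

/-! ### Counting derangements with prescribed values -/

section Derangements

variable {n : ℕ}

theorem card_filter_forall_apply_ne (α : Type*) [Fintype α] [DecidableEq α]
    [DecidablePred fun σ : Perm α => ∀ x, σ x ≠ x] :
    #(univ.filter fun σ : Perm α => ∀ x, σ x ≠ x) = numDerangements (Fintype.card α) := by
  rw [← card_derangements_eq_numDerangements, ← Fintype.card_subtype]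
  exact Fintype.card_congr (Equiv.subtypeEquivRight fun _ => Iff.rfl)

/-- The number of derangements with a prescribed value at one point. -/
theorem card_filter_apply_eq_derangement {i a : Fin n} (hai : a ≠ i) :
    #(univ.filter fun σ : Perm (Fin n) => σ i = a ∧ ∀ x, σ x ≠ x) =
      numDerangements (n - 1) + numDerangements (n - 2) := by
  -- Conjugation by `swap a b` fixes `i`, so the count does not depend on the value at `i`. Summing
  -- over the `n - 1` values gives `d_n = (n - 1)(d_{n-1} + d_{n-2})`.
  have hconst : ∀ b ∈ univ.erase i,
      #((univ.filter fun σ : Perm (Fin n) => ∀ x, σ x ≠ x).filter fun σ => σ i = b) =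
        #(univ.filter fun σ : Perm (Fin n) => σ i = a ∧ ∀ x, σ x ≠ x) := by
    intro b hb
    have hbi : b ≠ i := ne_of_mem_erase hb
    have hi : swap a b i = i := swap_apply_of_ne_of_ne hai.symm hbi.symm
    refine card_bij' (fun σ _ => swap a b * σ * swap a b) (fun σ _ => swap a b * σ * swap a b)
      ?_ ?_ ?_ ?_
    · intro σ hσ
      simp only [mem_filter, mem_univ, true_and, Perm.mul_apply] at hσ ⊢
      refine ⟨by rw [hi, hσ.2, swap_apply_right], fun x h => hσ.1 (swap a b x) ?_⟩
      rwa [swap_apply_eq_iff] at h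
    · intro σ hσ
      simp only [mem_filter, mem_univ, true_and, Perm.mul_apply] at hσ ⊢
      refine ⟨fun x h => hσ.2 (swap a b x) ?_, by rw [hi, hσ.1, swap_apply_left]⟩
      rwa [swap_apply_eq_iff] at h
    · intro σ _
      ext x
      simp
    · intro σ _
      ext x
      simp
  have hsum := card_eq_sum_card_fiberwise
    (s := univ.filter fun σ : Perm (Fin n) => ∀ x, σ x ≠ x) (t := univ.erase i) (f := fun σ => σ i)
    (fun σ hσ => by
      have := (mem_filter.1 hσ).2 i
      simpa using this)
  rw [sum_congr rfl hconst, sum_const, smul_eq_mul, card_filter_forall_apply_ne,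
    Fintype.card_fin, card_erase_of_mem (mem_univ _), card_univ, Fintype.card_fin] at hsum
  have hn : 2 ≤ n := by
    have := a.2
    have := i.2
    by_contra h
    exact hai (Fin.ext (by omega))
  obtain ⟨m, rfl⟩ := Nat.exists_eq_add_of_le' hn
  rw [numDerangements_add_two] at hsum
  rw [← Nat.eq_of_mul_eq_mul_left (Nat.succ_pos m) hsum]
  exact add_comm _ _

/-- The number of permutations with a prescribed value at one point that disagree everywhere with
a permutation `τ` not having that value. -/
theorem card_filter_apply_eq_forall_ne {i j : Fin n} {τ : Perm (Fin n)} (hτ : τ i ≠ j) :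
    #(univ.filter fun σ : Perm (Fin n) => σ i = j ∧ ∀ x, σ x ≠ τ x) =
      numDerangements (n - 1) + numDerangements (n - 2) := by
  have ha : τ.symm j ≠ i := fun h => hτ (by rw [← h, apply_symm_apply])
  rw [← card_filter_apply_eq_derangement ha]
  refine card_bij' (fun σ _ => τ⁻¹ * σ) (fun σ _ => τ * σ) ?_ ?_ ?_ ?_
  · intro σ hσ
    simp only [mem_filter, mem_univ, true_and, Perm.mul_apply] at hσ ⊢
    refine ⟨by rw [hσ.1]; rfl, fun x h => hσ.2 x ?_⟩
    rwa [Perm.inv_eq_iff_eq] at h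
  · intro σ hσ
    simp only [mem_filter, mem_univ, true_and, Perm.mul_apply] at hσ ⊢
    exact ⟨by rw [hσ.1, apply_symm_apply], fun x h => hσ.2 x (τ.injective h)⟩
  · simp
  · simp

theorem numDerangements_le_card_filter_apply_eq_apply_eq {i k a b : Fin n} (hik : i ≠ k)
    (hai : a ≠ i) (hbk : b ≠ k) (hab : a ≠ b) :
    numDerangements (n - 2) ≤
      #(univ.filter fun σ : Perm (Fin n) => σ i = a ∧ σ k = b ∧ ∀ x, σ x ≠ x) := by
  classical
  set p : Fin n → Prop := fun x => x ∉ ({i, k} : Finset (Fin n)) with hp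
  have hcard : Fintype.card {x // p x} = n - 2 := by
    rw [Fintype.card_subtype_compl, Fintype.card_fin, Fintype.card_coe, card_pair hik]
  rw [← hcard, ← card_filter_forall_apply_ne]
  -- The swaps route `i` to `a` and `k` to `b`. Elsewhere they alter a value of `ρ` only from `b` to
  -- `i` or from `a` to `k`, which creates no fixed point.
  set g : Perm {x // p x} → Perm (Fin n) := fun ρ =>
    swap k a * swap i b * (swap i k * Perm.ofSubtype ρ) with hg
  refine card_le_card_of_injOn g ?_ ?_
  · intro ρ hρ
    have hρ' : ∀ x, ρ x ≠ x := (mem_filter.1 hρ).2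
    have hi : Perm.ofSubtype ρ i = i := Perm.ofSubtype_apply_of_not_mem ρ (by simp [hp])
    have hk : Perm.ofSubtype ρ k = k := Perm.ofSubtype_apply_of_not_mem ρ (by simp [hp])
    have gi : g ρ i = a := by
      simp only [hg, Perm.mul_apply, hi, swap_apply_left]
      rw [swap_apply_of_ne_of_ne hik.symm hbk.symm, swap_apply_left]
    have gk : g ρ k = b := by
      simp only [hg, Perm.mul_apply, hk, swap_apply_right, swap_apply_left]
      rw [swap_apply_of_ne_of_ne hbk hab.symm]
    simp only [coe_filter, mem_univ, true_and, Set.mem_ofPred_eq]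
    refine ⟨gi, gk, fun x => ?_⟩
    by_cases hx : p x
    · have hx' := hx
      simp only [hp, mem_insert, mem_singleton, not_or] at hx'
      have hy : Perm.ofSubtype ρ x = ρ ⟨x, hx⟩ := Perm.ofSubtype_apply_of_mem ρ hx
      have hyx : (ρ ⟨x, hx⟩ : Fin n) ≠ x := fun h => hρ' ⟨x, hx⟩ (Subtype.ext h)
      have hyp := (ρ ⟨x, hx⟩).2
      simp only [hp, mem_insert, mem_singleton, not_or] at hyp
      simp only [hg, Perm.mul_apply, hy]
      generalize (ρ ⟨x, hx⟩ : Fin n) = y at *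
      rw [swap_apply_of_ne_of_ne hyp.1 hyp.2]
      by_cases hyb : y = b
      · rw [hyb, swap_apply_right, swap_apply_of_ne_of_ne hik hai.symm]
        exact Ne.symm hx'.1
      · rw [swap_apply_of_ne_of_ne hyp.1 hyb]
        by_cases hya : y = a
        · rw [hya, swap_apply_right]
          exact Ne.symm hx'.2
        · rwa [swap_apply_of_ne_of_ne hyp.2 hya]
    · simp only [hp, mem_insert, mem_singleton, not_not] at hx
      rcases hx with rfl | rfl
      · rwa [gi]
      · rwa [gk]
  · intro ρ _ ρ' _ h
    exact Perm.ofSubtype_injective (mul_left_cancel (mul_left_cancel h))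

/-- Otherwise any disagreement off `i` occurs at the preimage of `j` under `τ₁`. The preimage of `j`
under `τ₂` would then be a second point sent to `j` by `τ₁`; so there is no disagreement off `i`,
and hence none at all. -/
theorem exists_apply_ne_apply {i j : Fin n} {τ₁ τ₂ : Perm (Fin n)} (hne : τ₁ ≠ τ₂)
    (h₁ : τ₁ i ≠ j) (h₂ : τ₂ i ≠ j) : ∃ k, k ≠ i ∧ τ₁ k ≠ τ₂ k ∧ τ₁ k ≠ j := by
  by_contra! h
  have hk : ∀ k, k ≠ i → τ₁ k = τ₂ k := by
    intro k hki
    by_contra hne'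
    have hkj := h k hki hne'
    have h3 : τ₂.symm j ≠ i := fun e => h₂ (by rw [← e, apply_symm_apply])
    have h4 : τ₂.symm j ≠ k := fun e => hne' (by rw [hkj, ← e, apply_symm_apply])
    by_cases h5 : τ₁ (τ₂.symm j) = τ₂ (τ₂.symm j)
    · rw [apply_symm_apply] at h5
      exact h4 (τ₁.injective (h5.trans hkj.symm))
    · exact h4 (τ₁.injective ((h _ h3 h5).trans hkj.symm))
  refine hne (Equiv.ext fun x => ?_)
  by_cases hx : x = i
  · subst hx
    by_contra hx
    have h3 : τ₂.symm (τ₁ x) ≠ x := fun e => hx (by rw [← e, apply_symm_apply, e])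
    have h4 := hk _ h3
    rw [apply_symm_apply] at h4
    exact h3 (τ₁.injective h4)
  · exact hk x hx

/-- Force agreement with `τ₁` at a point `k` where `τ₂` differs; left translation by `τ₂⁻¹` turns
this into derangements with two prescribed values. -/
theorem numDerangements_le_card_filter_meet_avoid {i j : Fin n} {τ₁ τ₂ : Perm (Fin n)}
    (hne : τ₁ ≠ τ₂) (h₁ : τ₁ i ≠ j) (h₂ : τ₂ i ≠ j) :
    numDerangements (n - 2) ≤ #(univ.filter fun σ : Perm (Fin n) =>
      σ i = j ∧ (∃ x, σ x = τ₁ x) ∧ ∀ x, σ x ≠ τ₂ x) := by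
  obtain ⟨k, hki, hk, hkj⟩ := exists_apply_ne_apply hne h₁ h₂
  refine (numDerangements_le_card_filter_apply_eq_apply_eq (i := i) (k := k) (a := τ₂.symm j)
    (b := τ₂.symm (τ₁ k)) hki.symm ?_ ?_ ?_).trans ?_
  · intro e
    exact h₂ (by rw [← e, apply_symm_apply])
  · intro e
    exact hk (by rw [← τ₂.apply_symm_apply (τ₁ k), e])
  · intro e
    exact hkj (τ₂.symm.injective e).symm
  · refine card_le_card_of_injOn (fun σ => τ₂ * σ) ?_ fun σ _ σ' _ h => mul_left_cancel h
    intro σ hσ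
    simp only [coe_filter, mem_univ, true_and, Set.mem_ofPred_eq, Perm.mul_apply] at hσ ⊢
    exact ⟨by rw [hσ.1, apply_symm_apply], ⟨k, by rw [hσ.2.1, apply_symm_apply]⟩,
      fun x h => hσ.2.2 x (τ₂.injective h)⟩

/-- At `m = n - 2` this offsets the `(n - 3)!` members allowed outside the star. -/
theorem factorial_sub_one_le_numDerangements {m : ℕ} (hm : 2 ≤ m) :
    (m - 1).factorial ≤ numDerangements m := by
  induction m, hm using Nat.le_induction with
  | base => decide
  | succ m hm ih =>
    obtain ⟨l, rfl⟩ := Nat.exists_eq_add_of_le' hm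
    rw [show l + 2 + 1 = (l + 1) + 2 from rfl, numDerangements_add_two]
    calc (l + 1 + 2 - 1).factorial = (l + 2) * (l + 2 - 1).factorial := Nat.factorial_succ (l + 1)
      _ ≤ (l + 1 + 1) * (numDerangements (l + 1) + numDerangements (l + 1 + 1)) := by
        gcongr
        exact ih.trans (Nat.le_add_left _ _)

end Derangements

/-! ### The extremal family and near-stars -/

section Extremal

variable {n : ℕ}

/-- The permutations that map `i` to `j` and agree somewhere with `τ`, together with `τ`. -/
def starWith (i j : Fin n) (τ : Perm (Fin n)) : Finset (Perm (Fin n)) :=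
  insert τ (univ.filter fun σ : Perm (Fin n) => σ i = j ∧ ∃ x, σ x = τ x)

theorem familyC_eq_starWith (hn : 2 ≤ n) :
    familyC n hn = starWith ⟨0, by omega⟩ ⟨0, by omega⟩ (swap ⟨0, by omega⟩ ⟨1, by omega⟩) := by
  rw [familyC, starWith, union_comm, ← insert_eq]
  congr 1
  refine filter_congr fun σ _ => and_congr_right fun h0 => exists_congr fun x => ?_
  by_cases hx0 : x = ⟨0, by omega⟩
  · subst hx0
    simp [h0]
  by_cases hx1 : x = ⟨1, by omega⟩
  · subst hx1
    rw [swap_apply_right, ← h0]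
    simp
  · rw [swap_apply_of_ne_of_ne hx0 hx1]
    have h1 : x.val ≠ 0 := fun h => hx0 (Fin.ext h)
    have h2 : x.val ≠ 1 := fun h => hx1 (Fin.ext h)
    exact and_iff_right (by omega)

theorem card_filter_meet_add {i j : Fin n} {τ : Perm (Fin n)} (hτ : τ i ≠ j) :
    #(univ.filter fun σ : Perm (Fin n) => σ i = j ∧ ∃ x, σ x = τ x) +
      (numDerangements (n - 1) + numDerangements (n - 2)) = (n - 1).factorial := by
  -- Here `swap i j` serves only as some permutation sending `i` to `j`.
  have h := card_filter_eqOn (swap i j) {i}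
  simp only [mem_singleton, forall_eq, swap_apply_left, card_singleton] at h
  rw [← h, ← card_filter_apply_eq_forall_ne hτ, ← card_filter_add_card_filter_not
    (s := univ.filter fun σ : Perm (Fin n) => σ i = j) fun σ => ∃ x, σ x = τ x, filter_filter,
    filter_filter]
  simp only [not_exists]

theorem card_starWith_add {i j : Fin n} {τ : Perm (Fin n)} (hτ : τ i ≠ j) :
    #(starWith i j τ) + (numDerangements (n - 1) + numDerangements (n - 2)) =
      (n - 1).factorial + 1 := by
  rw [starWith, card_insert_of_notMem (by simp [hτ]), ← card_filter_meet_add hτ]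
  omega

theorem card_familyC_add (hn : 2 ≤ n) :
    #(familyC n hn) + (numDerangements (n - 1) + numDerangements (n - 2)) =
      (n - 1).factorial + 1 := by
  rw [familyC_eq_starWith]
  exact card_starWith_add (by simp)

theorem isIntersecting_familyC (hn : 2 ≤ n) : IsIntersecting (familyC n hn) := by
  rw [familyC_eq_starWith]
  intro σ hσ π hπ
  simp only [starWith, mem_insert, mem_filter, mem_univ, true_and] at hσ hπ
  rcases hσ with rfl | hσ <;> rcases hπ with rfl | hπ
  · exact ⟨⟨0, by omega⟩, rfl⟩
  · obtain ⟨x, hx⟩ := hπ.2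
    exact ⟨x, hx.symm⟩
  · exact hσ.2
  · exact ⟨⟨0, by omega⟩, hσ.1.trans hπ.1.symm⟩

theorem not_isCentred_familyC (hn : 2 ≤ n) (hn' : 4 ≤ n) : ¬ IsCentred (familyC n hn) := by
  rintro ⟨i, j, h⟩
  have hmem : ∀ σ : Perm (Fin n), σ ⟨0, by omega⟩ = ⟨0, by omega⟩ →
      (∃ x : Fin n, 1 < x.val ∧ σ x = x) → σ ∈ familyC n hn := fun σ h0 hx =>
    mem_union_left _ (mem_filter.2 ⟨mem_univ _, h0, hx⟩)
  -- The identity forces `i = j`, the transposition forces `i` away from the first two points, and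
  -- then `swap 1 i` moves `i`. It lies in the family because `n ≥ 4` leaves another fixed point.
  have h1 := h 1 (hmem 1 rfl ⟨⟨2, by omega⟩, by simp, rfl⟩)
  rw [Perm.one_apply] at h1
  subst h1
  have h2 := h (swap ⟨0, by omega⟩ ⟨1, by omega⟩) (mem_union_right _ (mem_singleton_self _))
  have hi0 : i ≠ ⟨0, by omega⟩ := by
    intro e
    simp [e] at h2
  have hi1 : i ≠ ⟨1, by omega⟩ := by
    intro e
    simp [e] at h2
  obtain ⟨x, hx, hxi⟩ : ∃ x : Fin n, 1 < x.val ∧ x ≠ i := by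
    by_cases hi2 : i = ⟨2, by omega⟩
    · exact ⟨⟨3, by omega⟩, by simp, by simp [hi2]⟩
    · exact ⟨⟨2, by omega⟩, by simp, Ne.symm hi2⟩
  have h3 := h (swap ⟨1, by omega⟩ i) (hmem _
    (swap_apply_of_ne_of_ne (by simp) hi0.symm) ⟨x, hx,
      swap_apply_of_ne_of_ne (fun e => by simp [e] at hx) hxi⟩)
  rw [swap_apply_right] at h3
  exact hi1 h3.symm

theorem isDoubleTranslate_starWith (hn : 2 ≤ n) {i j : Fin n} {τ : Perm (Fin n)} (hτ : τ i ≠ j) :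
    IsDoubleTranslate (starWith i j τ) (familyC n hn) := by
  set o : Fin n := ⟨0, by omega⟩ with ho
  set e : Fin n := ⟨1, by omega⟩ with he
  have hoe : o ≠ e := by simp [ho, he]
  have hk : τ.symm j ≠ i := fun h => hτ (by rw [← h, apply_symm_apply])
  -- The exceptional `τ` must correspond to the transposition `(o e)`: `ρ` moves `i` and the
  -- preimage of `j` to `o` and `e`, after which `π` is determined by `π * swap o e * ρ = τ`.
  obtain ⟨ρ, hρi, hρk⟩ : ∃ ρ : Perm (Fin n), ρ i = o ∧ ρ (τ.symm j) = e := by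
    refine ⟨swap (swap i o (τ.symm j)) e * swap i o, ?_, ?_⟩
    · rw [Perm.mul_apply, swap_apply_left]
      refine swap_apply_of_ne_of_ne (fun h => hk ?_) hoe
      exact ((swap i o).injective ((swap_apply_left i o).trans h)).symm
    · rw [Perm.mul_apply, swap_apply_left]
  set π : Perm (Fin n) := τ * ρ⁻¹ * swap o e with hπ
  have hπo : π o = j := by
    rw [hπ, Perm.mul_apply, Perm.mul_apply, swap_apply_left, ← hρk]
    simp
  have hπs : π * swap o e * ρ = τ := by
    ext x
    simp [hπ]
  have hτx : ∀ x, τ x = π (swap o e (ρ x)) := fun x => by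
    rw [← Perm.mul_apply, ← Perm.mul_apply, hπs]
  refine ⟨π, ρ, ?_⟩
  rw [familyC_eq_starWith hn, starWith, starWith, image_insert, hπs]
  congr 1
  ext σ
  simp only [mem_filter, mem_univ, true_and, mem_image]
  constructor
  · rintro ⟨h1, x, hx⟩
    refine ⟨π⁻¹ * σ * ρ⁻¹, ⟨?_, ρ x, ?_⟩, by ext; simp⟩
    · rw [Perm.mul_apply, Perm.mul_apply, Perm.inv_eq_iff_eq, ← ho, hπo, ← hρi]
      simpa using h1
    · rw [Perm.mul_apply, Perm.mul_apply, Perm.inv_eq_iff_eq, ← hτx, ← hx]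
      simp
  · rintro ⟨σ, ⟨h1, x, hx⟩, rfl⟩
    refine ⟨?_, ρ⁻¹ x, ?_⟩
    · rw [Perm.mul_apply, Perm.mul_apply, hρi, h1, hπo]
    · rw [hτx, Perm.mul_apply, Perm.mul_apply]
      congr 1
      simpa using hx

theorem IsDoubleTranslate.card_eq {A F : Finset (Perm (Fin n))} (h : IsDoubleTranslate A F) :
    #A = #F := by
  obtain ⟨π, τ, rfl⟩ := h
  exact card_image_of_injective _ fun σ σ' h => mul_left_cancel (mul_right_cancel h)

/-- An intersecting family with at least two but at most `(n - 3)!` members outside a star is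
smaller than the extremal family. -/
theorem IsIntersecting.card_lt_card_familyC (hn : 4 ≤ n) {A : Finset (Perm (Fin n))}
    (hA : IsIntersecting A) {i j : Fin n}
    (h1 : 1 < #(A.filter fun σ => σ i ≠ j))
    (h2 : #(A.filter fun σ => σ i ≠ j) ≤ (n - 3).factorial) :
    #A < #(familyC n (by omega)) := by
  obtain ⟨τ₁, hτ₁, τ₂, hτ₂, hne⟩ := one_lt_card.1 h1
  rw [mem_filter] at hτ₁ hτ₂
  have hsplit : #(A.filter fun σ => σ i = j) + #(A.filter fun σ => σ i ≠ j) = #A :=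
    card_filter_add_card_filter_not _
  have hmeet := card_filter_meet_add hτ₁.2
  have hC := card_familyC_add (n := n) (by omega)
  have hlow := (factorial_sub_one_le_numDerangements (m := n - 2) (by omega)).trans
    (numDerangements_le_card_filter_meet_avoid hne hτ₁.2 hτ₂.2)
  have hdisj : Disjoint (A.filter fun σ => σ i = j) (univ.filter fun σ : Perm (Fin n) =>
      σ i = j ∧ (∃ x, σ x = τ₁ x) ∧ ∀ x, σ x ≠ τ₂ x) := by
    refine disjoint_left.2 fun σ hσ hσ' => ?_
    obtain ⟨x, hx⟩ := hA σ (mem_filter.1 hσ).1 τ₂ hτ₂.1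
    exact (mem_filter.1 hσ').2.2.2 x hx
  have hsub : (A.filter fun σ => σ i = j) ∪ (univ.filter fun σ : Perm (Fin n) =>
      σ i = j ∧ (∃ x, σ x = τ₁ x) ∧ ∀ x, σ x ≠ τ₂ x) ⊆
      univ.filter fun σ : Perm (Fin n) => σ i = j ∧ ∃ x, σ x = τ₁ x := by
    intro σ hσ
    simp only [mem_union, mem_filter, mem_univ, true_and] at hσ ⊢
    rcases hσ with hσ | hσ
    · exact ⟨hσ.2, hA σ hσ.1 τ₁ hτ₁.1⟩
    · exact ⟨hσ.1, hσ.2.1⟩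
  have hle := card_le_card hsub
  rw [card_union_of_disjoint hdisj] at hle
  rw [show n - 2 - 1 = n - 3 by omega] at hlow
  omega

/-- A non-centred intersecting family at most `(n - 3)!` of whose members lie outside a star is
no larger than the extremal family, and is a double translate of it in case of equality. -/
theorem IsIntersecting.card_le_card_familyC (hn : 4 ≤ n) {A : Finset (Perm (Fin n))}
    (hA : IsIntersecting A) (hA' : ¬ IsCentred A) {i j : Fin n}
    (h : #(A.filter fun σ => σ i ≠ j) ≤ (n - 3).factorial) :
    #A ≤ #(familyC n (by omega)) ∧
      (#A = #(familyC n (by omega)) → IsDoubleTranslate A (familyC n (by omega))) := by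
  rcases lt_or_ge 1 #(A.filter fun σ => σ i ≠ j) with h1 | h1
  · have := hA.card_lt_card_familyC hn h1 h
    exact ⟨this.le, fun e => absurd e this.ne⟩
  · obtain ⟨τ, hτA, hτ⟩ : ∃ τ ∈ A, τ i ≠ j := by
      by_contra! hc
      exact hA' ⟨i, j, hc⟩
    have hsub : A ⊆ starWith i j τ := by
      intro σ hσ
      rw [starWith, mem_insert, mem_filter]
      by_cases hσi : σ i = j
      · exact Or.inr ⟨mem_univ _, hσi, hA σ hσ τ hτA⟩
      · exact Or.inl (card_le_one.1 h1 σ (mem_filter.2 ⟨hσ, hσi⟩) τ (mem_filter.2 ⟨hτA, hτ⟩))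
    have hT := isDoubleTranslate_starWith (n := n) (by omega) hτ
    refine ⟨(card_le_card hsub).trans hT.card_eq.le, fun e => ?_⟩
    rwa [eq_of_subset_of_card_le hsub (hT.card_eq.trans e.symm).le]

theorem tendsto_card_familyC_div_factorial :
    Filter.Tendsto (fun m : ℕ => (#(familyC (m + 2) (Nat.le_add_left 2 m)) : ℝ) /
      (Nat.factorial (m + 1) : ℝ)) Filter.atTop (nhds (1 - 1 / Real.exp 1)) := by
  have h0 := numDerangements_tendsto_inv_e
  have h1 := h0.comp (Filter.tendsto_add_atTop_nat 1)
  have h2 := h0.mul (tendsto_one_div_add_atTop_nhds_zero_nat (𝕜 := ℝ))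
  have h3 : Filter.Tendsto (fun m : ℕ => (1 : ℝ) / (m + 1).factorial) Filter.atTop (nhds 0) := by
    refine squeeze_zero (fun m => by positivity) (fun m => ?_)
      (tendsto_one_div_add_atTop_nhds_zero_nat (𝕜 := ℝ))
    gcongr
    exact_mod_cast Nat.self_le_factorial (m + 1)
  have h4 := ((h1.const_sub 1).sub h2).add h3
  rw [mul_zero, sub_zero, add_zero, Real.exp_neg, ← one_div] at h4
  refine h4.congr fun m => ?_
  have hc := card_familyC_add (Nat.le_add_left 2 m)
  have hc' : (#(familyC (m + 2) (Nat.le_add_left 2 m)) : ℝ) +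
      (numDerangements (m + 1) + numDerangements m) = (m + 1).factorial + 1 := by exact_mod_cast hc
  rw [eq_sub_of_add_eq hc']
  have hf : ((m + 1).factorial : ℝ) = (m + 1) * m.factorial := by
    exact_mod_cast Nat.factorial_succ m
  have hm : (m.factorial : ℝ) ≠ 0 := by positivity
  have hm' : (m : ℝ) + 1 ≠ 0 := by positivity
  simp only [Function.comp_apply]
  rw [hf]
  field_simp
  ring

/-- The limit `1 - 1/e` exceeds `1/2` because `e > 2`. -/
theorem exists_forall_factorial_le_two_mul_card_familyC :
    ∃ N : ℕ, ∀ (n : ℕ) (hn : 2 ≤ n), N ≤ n → (n - 1).factorial ≤ 2 * #(familyC n hn) := by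
  have hlt : (1 / 2 : ℝ) < 1 - 1 / Real.exp 1 := by
    have h2 : (2 : ℝ) < Real.exp 1 := lt_trans (by norm_num) Real.exp_one_gt_d9
    have := one_div_lt_one_div_of_lt (by norm_num) h2
    linarith
  obtain ⟨N, hN⟩ := Filter.eventually_atTop.1
    (tendsto_card_familyC_div_factorial.eventually (lt_mem_nhds hlt))
  refine ⟨N + 2, fun n hn hNn => ?_⟩
  obtain ⟨m, rfl⟩ := Nat.exists_eq_add_of_le' hn
  have h := hN m (by omega)
  rw [lt_div_iff₀ (by positivity)] at h
  have h' : ((m + 1).factorial : ℝ) ≤ 2 * #(familyC (m + 2) hn) := by linarith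
  exact_mod_cast h'

end Extremal

end CameronKu

/-! ### Assembly of the main theorem -/

theorem mainTheorem1 :
    (∃ N : ℕ, ∀ (n : ℕ) (hn : 2 ≤ n), N ≤ n →
      (CameronKu.IsIntersecting (CameronKu.familyC n hn) ∧
        ¬ CameronKu.IsCentred (CameronKu.familyC n hn)) ∧
      ((CameronKu.familyC n hn).card : ℤ) =
        (Nat.factorial (n - 1) : ℤ) - (numDerangements (n - 1) : ℤ)
          - (numDerangements (n - 2) : ℤ) + 1 ∧
      ∀ A : Finset (Equiv.Perm (Fin n)),
        CameronKu.IsIntersecting A → ¬ CameronKu.IsCentred A →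
          A.card ≤ (CameronKu.familyC n hn).card ∧
          (A.card = (CameronKu.familyC n hn).card ↔
            CameronKu.IsDoubleTranslate A (CameronKu.familyC n hn))) ∧
    Filter.Tendsto
      (fun m : ℕ => ((CameronKu.familyC (m + 2) (Nat.le_add_left 2 m)).card : ℝ) /
        (Nat.factorial (m + 1) : ℝ))
      Filter.atTop (nhds (1 - 1 / Real.exp 1)) := by
  refine ⟨?_, CameronKu.tendsto_card_familyC_div_factorial⟩
  obtain ⟨N₁, hN₁⟩ := CameronKu.exists_forall_isIntersecting_stability
  obtain ⟨N₂, hN₂⟩ := CameronKu.exists_forall_factorial_le_two_mul_card_familyC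
  refine ⟨N₁ + N₂ + 300, fun n hn hNn => ⟨⟨CameronKu.isIntersecting_familyC hn,
    CameronKu.not_isCentred_familyC hn (by omega)⟩, ?_, fun A hA hA' => ?_⟩⟩
  · have := CameronKu.card_familyC_add hn
    omega
  · suffices h : A.card ≤ (CameronKu.familyC n hn).card ∧
        (A.card = (CameronKu.familyC n hn).card →
          CameronKu.IsDoubleTranslate A (CameronKu.familyC n hn)) from
      ⟨h.1, h.2, CameronKu.IsDoubleTranslate.card_eq⟩
    rcases hN₁ n (by omega) A hA with ⟨i, j, h⟩ | h
    · exact hA.card_le_card_familyC (by omega) hA' h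
    · have hlt : A.card < (CameronKu.familyC n hn).card := by
        have hC := hN₂ n hn (by omega)
        obtain ⟨m, rfl⟩ := Nat.exists_eq_add_of_le' (show 3 ≤ n by omega)
        have e1 : (m + 3 - 1).factorial = (m + 2) * (m + 3 - 2).factorial :=
          Nat.factorial_succ (m + 1)
        have e2 : (m + 3 - 3).factorial ≤ (m + 3 - 2).factorial :=
          Nat.factorial_le (by omega)
        have e3 := Nat.factorial_pos (m + 3 - 2)
        nlinarith
      exact ⟨hlt.le, fun e => absurd e hlt.ne⟩
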